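/- Let $d\ge 3$. For a $d$-uniform hypergraph $H$ on a finite vertex set $V$, the projection $\mathrm{Proj}(H)$ is the graph on $V$ in which two distinct vertices are adjacent iff some hyperedge of $H$ contains both. A $d$-uniform hypergraph $H$ on $V$ is a preimage of a graph $G$ on $V$ if $\mathrm{Proj}(H)=G$, and a minimal preimage if moreover it has the least number of hyperedges among all preimages of $G$. The graph $G$ is ambiguous if it has at least two distinct minimal preimages. Let $m(H)=\max_{K} |E(K)|/|V(K)|$, where $K$ ranges over the subhypergraphs of $H$ with at least one vertex. (i) If $h$ is any (not necessarily minimal) preimage of an ambiguous graph, then $$d-1-\frac{1}{m(h)}\;\ge\;\frac{2d-4}{2d-1}.$$ (ii) The bound is tight. Consider the vertex set $$\{u,w\}\sqcup\{v_1,\dots,v_{d-1}\}\sqcup\bigsqcup_{i=1}^{d-1}S_i^u\sqcup\bigsqcup_{i=1}^{d-1}S_i^w,\qquad |S_i^u|=|S_i^w|=d-2,$$ and for $x\in\{u,w\}$ let $H_x$ be the $d$-uniform hypergraph on it with hyperedges $\{x,v_1,\dots,v_{d-1}\}$, $\{u,v_i\}\cup S_i^u$ and $\{w,v_i\}\cup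 S_i^w$ for $1\le i\le d-1$. Then $G_{a,d}:=\mathrm{Proj}(H_u)$ is ambiguous, both $H_u$ and $H_w$ are minimal preimages of $G_{a,d}$, and for $x\in\{u,w\}$ $$d-1-\frac{1}{m(H_x)}=\frac{2d-4}{2d-1}.$$ -/

import Mathlib

/-- A `d`-uniform hypergraph with vertex set `V`: a finite set of hyperedges, each of which is a
`d`-element subset of `V`. -/
@[ext]
structure UniformHypergraph (d : ℕ) (V : Type*) where
  /-- The set of hyperedges. -/
  edges : Finset (Finset V)
  /-- Every hyperedge has exactly `d` vertices. -/
  uniform : ∀ e ∈ edges, e.card = d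

namespace UniformHypergraph

variable {d : ℕ} {V : Type*}

/-- The projection of `H`: the graph on the same vertex set in which two distinct vertices are
adjacent iff some hyperedge contains both. -/
def proj (H : UniformHypergraph d V) : SimpleGraph V where
  Adj i j := i ≠ j ∧ ∃ e ∈ H.edges, i ∈ e ∧ j ∈ e
  symm := ⟨fun _ _ h => ⟨h.1.symm, h.2.imp fun _ he => ⟨he.1, he.2.2, he.2.1⟩⟩⟩
  loopless := ⟨fun _ h => h.1 rfl⟩

/-- A subhypergraph `K ≤ H` (with at least one vertex): a set of vertices, and a set of hyperedges
of `H` lying inside this set of vertices. -/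
structure Sub (H : UniformHypergraph d V) where
  /-- The vertices of the subhypergraph. -/
  verts : Finset V
  /-- The hyperedges of the subhypergraph. -/
  edges : Finset (Finset V)
  nonempty : verts.Nonempty
  edges_subset : edges ⊆ H.edges
  edge_subset_verts : ∀ e ∈ edges, e ⊆ verts

/-- The ratio `α(K) = e(K) / v(K)` of a subhypergraph. -/
noncomputable def Sub.ratio {H : UniformHypergraph d V} (K : H.Sub) : ℝ :=
  (K.edges.card : ℝ) / (K.verts.card : ℝ)

/-- `m(H)`, the maximum of `α(K)` over the subhypergraphs `K` of `H`.  For a finite nonempty vertex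
set the maximum is attained, see `isGreatest_maxRatio`. -/
noncomputable def maxRatio (H : UniformHypergraph d V) : ℝ :=
  ⨆ K : H.Sub, K.ratio

instance finite_sub [Finite V] (H : UniformHypergraph d V) : Finite H.Sub := by
  apply Finite.of_injective
    (fun K : H.Sub => ((K.verts, K.edges) : Finset V × Finset (Finset V)))
  rintro ⟨v, e, _, _, _⟩ ⟨v', e', _, _, _⟩ h
  simp only [Prod.mk.injEq] at h
  obtain ⟨rfl, rfl⟩ := h
  rfl

theorem isGreatest_maxRatio [Finite V] [Nonempty V] (H : UniformHypergraph d V) :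
    IsGreatest (Set.range fun K : H.Sub => K.ratio) H.maxRatio := by
  have : Nonempty H.Sub :=
    ⟨⟨{Classical.arbitrary V}, ∅, by simp, by simp, by simp⟩⟩
  obtain ⟨K, hK⟩ := Finite.exists_max fun K : H.Sub => K.ratio
  have h : H.maxRatio = K.ratio :=
    le_antisymm (ciSup_le hK) (le_ciSup (f := fun K : H.Sub => K.ratio)
      (Set.finite_range _).bddAbove K)
  refine ⟨⟨K, h.symm⟩, ?_⟩
  rintro _ ⟨L, rfl⟩
  rw [h]
  exact hK L

/-- `H` is a preimage of the graph `G`. -/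
def IsPreimage (H : UniformHypergraph d V) (G : SimpleGraph V) : Prop :=
  H.proj = G

/-- `H` is a preimage of `G` with the least number of hyperedges among all preimages of `G`. -/
def IsMinimalPreimage (H : UniformHypergraph d V) (G : SimpleGraph V) : Prop :=
  H.IsPreimage G ∧ ∀ H' : UniformHypergraph d V, H'.IsPreimage G → H.edges.card ≤ H'.edges.card

end UniformHypergraph

/-- The graph `G` is ambiguous (with respect to `d`-uniform hypergraphs): it has at least two
distinct minimal preimages. -/
def IsAmbiguous (d : ℕ) {V : Type*} (G : SimpleGraph V) : Prop :=
  ∃ H₁ H₂ : UniformHypergraph d V,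
    H₁ ≠ H₂ ∧ H₁.IsMinimalPreimage G ∧ H₂.IsMinimalPreimage G

namespace AmbiguousExample

/-- The vertex set of `G_{a,d}`, a disjoint union of `{u, w}`, of `{v_i : i}` and of the sets
`S_i^u` and `S_i^w`, where `i` ranges over `d - 1` indices and each `S_i^u`, `S_i^w` has `d - 2`
elements.  The Boolean `true` stands for `u` and `false` for `w`. -/
abbrev Vertex (d : ℕ) : Type :=
  Bool ⊕ Fin (d - 1) ⊕ (Bool × Fin (d - 1) × Fin (d - 2))

variable {d : ℕ}

/-- The vertex `u` (for `true`) or `w` (for `false`). -/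
abbrev apex (d : ℕ) (b : Bool) : Vertex d := Sum.inl b

/-- The vertex `v_i`. -/
abbrev mid (i : Fin (d - 1)) : Vertex d := Sum.inr (Sum.inl i)

/-- The set `S_i^u` (for `true`) or `S_i^w` (for `false`). -/
def leaves (b : Bool) (i : Fin (d - 1)) : Finset (Vertex d) :=
  Finset.univ.image fun k : Fin (d - 2) => Sum.inr (Sum.inr (b, i, k))

/-- The hyperedge `{u} ∪ {v_i : i}` (for `true`) or `{w} ∪ {v_i : i}` (for `false`). -/
def center (d : ℕ) (b : Bool) : Finset (Vertex d) :=
  insert (apex d b) (Finset.univ.image mid)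

/-- The hyperedge `{u, v_i} ∪ S_i^u` (for `true`) or `{w, v_i} ∪ S_i^w` (for `false`). -/
def petal (b : Bool) (i : Fin (d - 1)) : Finset (Vertex d) :=
  {apex d b, mid i} ∪ leaves b i

theorem card_center (hd : 2 ≤ d) (b : Bool) : (center d b).card = d := by
  rw [center, Finset.card_insert_of_notMem (by simp),
    Finset.card_image_of_injective _ (fun i j h => by simpa using h)]
  simp
  omega

theorem card_petal (hd : 2 ≤ d) (b : Bool) (i : Fin (d - 1)) :
    (petal b i : Finset (Vertex d)).card = d := by
  rw [petal, Finset.card_union_of_disjoint (by simp [leaves]), Finset.card_pair (by simp),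
    leaves, Finset.card_image_of_injective _ (fun i j h => by simpa using h)]
  simp
  omega

/-- The hypergraph whose hyperedges are all the sets `{u, v_i} ∪ S_i^u` and `{w, v_i} ∪ S_i^w`,
together with `{u} ∪ {v_i : i}` (for `c = true`) or `{w} ∪ {v_i : i}` (for `c = false`). -/
def hypergraph (d : ℕ) (hd : 2 ≤ d) (c : Bool) : UniformHypergraph d (Vertex d) where
  edges := insert (center d c)
    (Finset.univ.image fun x : Bool × Fin (d - 1) => petal x.1 x.2)
  uniform := by
    intro e he
    rcases Finset.mem_insert.1 he with rfl | he
    · exact card_center hd c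
    · obtain ⟨x, -, rfl⟩ := Finset.mem_image.1 he
      exact card_petal hd x.1 x.2

/-- The graph `G_{a,d}`: the projection of the hypergraph that contains `{u} ∪ {v_i : i}`. -/
def graph (d : ℕ) (hd : 2 ≤ d) : SimpleGraph (Vertex d) :=
  (hypergraph d hd true).proj

end AmbiguousExample

/-! Since `d - 1 - 1/m` increases with `m`, the bound says that `h` has a subhypergraph with `(2d-1)
* vertices ≤ (2d²-5d+5) * edges`. Take a minimal preimage `H ≠ h` and compare `T = H \ h` with `U =
h \ H`, so that `|T| ≤ |U|`. If some edge of `U` shares no pair with an edge of `T`, all its pairs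
are covered by other edges of `h`, and that edge with its neighbours is dense
(`exists_sub_of_redundant`).

Otherwise let `W` be the support of `U` and of the edges of `T` that share a pair with `U`, and add
to both families the common edges inside `W`. A pair joined by only one of the two families must be
covered by an edge of `h` that leaves `W`. Such an edge, added to `W` with its outside vertices,
raises the density in proportion to the pairs it covers (`exists_sub_of_pairs`). Hence either `U` is
dense on `W` or there are many such pairs. The trade-off is `IsBlockPair.card_blockSupport_le`,
proved by discharging from blocks to points, separately for `d = 3`, `d = 4` and `d ≥ 5`.

For tightness, the leaves force every petal into each preimage, while the clique on the `v_i` can be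
completed through `u` or `w`. Counting vertices bounds every density from above, and the first part
supplies the matching lower bound. -/

open Finset

/-! ### Two families of blocks, and the pairs joined by only one of them -/

section BlockPair

variable {V : Type*} [DecidableEq V]

/-- The blocks of `T` through the point `x`. -/
def blocksAt (T : Finset (Finset V)) (x : V) : Finset (Finset V) := T.filter (x ∈ ·)

/-- The points other than `x` that lie in a common block of `T` with `x`. -/
def blockNbrs (T : Finset (Finset V)) (x : V) : Finset V := ((blocksAt T x).biUnion id).erase x

/-- The points that are joined to `x` by exactly one of the two families of blocks. -/
def symmNbrs (T U : Finset (Finset V)) (x : V) : Finset V := symmDiff (blockNbrs T x) (blockNbrs U x)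

/-- The points covered by the blocks of two families. -/
def blockSupport (T U : Finset (Finset V)) : Finset V := (T ∪ U).biUnion id

/-- Two families of `d`-element blocks, such that each block shares a pair with a block of the
other family, and each point lies in a block that belongs to only one of the families. -/
structure IsBlockPair (d : ℕ) (T U : Finset (Finset V)) : Prop where
  card_left : ∀ C ∈ T, C.card = d
  card_right : ∀ C ∈ U, C.card = d
  meet_left : ∀ C ∈ T, ∃ D ∈ U, 2 ≤ (C ∩ D).card
  meet_right : ∀ C ∈ U, ∃ D ∈ T, 2 ≤ (C ∩ D).card
  exists_not_common : ∀ x ∈ blockSupport T U, ∃ C, x ∈ C ∧ (C ∈ T ∧ C ∉ U ∨ C ∈ U ∧ C ∉ T)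

variable {d : ℕ} {T U : Finset (Finset V)} {x y : V}

@[simp] theorem mem_blocksAt {C : Finset V} : C ∈ blocksAt T x ↔ C ∈ T ∧ x ∈ C := by
  simp [blocksAt]

theorem mem_blockNbrs : y ∈ blockNbrs T x ↔ y ≠ x ∧ ∃ C ∈ T, x ∈ C ∧ y ∈ C := by
  simp [blockNbrs, and_assoc]

theorem mem_blockNbrs_comm : y ∈ blockNbrs T x ↔ x ∈ blockNbrs T y := by
  simp only [mem_blockNbrs, ne_comm, and_comm (a := x ∈ _)]

theorem mem_symmNbrs : y ∈ symmNbrs T U x ↔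
    y ∈ blockNbrs T x ∧ y ∉ blockNbrs U x ∨ y ∈ blockNbrs U x ∧ y ∉ blockNbrs T x := by
  simp [symmNbrs, Finset.mem_symmDiff]

theorem mem_symmNbrs_comm : y ∈ symmNbrs T U x ↔ x ∈ symmNbrs T U y := by
  simp only [mem_symmNbrs, mem_blockNbrs_comm (x := x)]

theorem symmNbrs_comm : symmNbrs T U x = symmNbrs U T x := symmDiff_comm _ _

theorem blockSupport_comm : blockSupport T U = blockSupport U T := by
  rw [blockSupport, union_comm, blockSupport]

theorem mem_blockSupport : x ∈ blockSupport T U ↔ ∃ C, (C ∈ T ∨ C ∈ U) ∧ x ∈ C := by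
  simp [blockSupport]

theorem symmNbrs_subset_blockSupport : symmNbrs T U x ⊆ blockSupport T U := by
  intro y hy
  rw [mem_symmNbrs, mem_blockNbrs, mem_blockNbrs] at hy
  rw [mem_blockSupport]
  rcases hy with ⟨⟨-, C, hC, -, h⟩, -⟩ | ⟨⟨-, C, hC, -, h⟩, -⟩
  · exact ⟨C, Or.inl hC, h⟩
  · exact ⟨C, Or.inr hC, h⟩

theorem blockNbrs_of_blocksAt_eq_singleton {A : Finset V} (h : blocksAt T x = {A}) :
    blockNbrs T x = A.erase x := by
  simp [blockNbrs, h]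

theorem blockNbrs_of_blocksAt_eq_empty (h : blocksAt T x = ∅) : blockNbrs T x = ∅ := by
  simp [blockNbrs, h]

theorem mem_of_blocksAt_eq_singleton {A : Finset V} (h : blocksAt T x = {A}) : A ∈ T ∧ x ∈ A :=
  mem_blocksAt.1 (h ▸ mem_singleton_self A)

theorem blocksAt_nonempty_or (hx : x ∈ blockSupport T U) :
    (blocksAt T x).Nonempty ∨ (blocksAt U x).Nonempty := by
  obtain ⟨C, h | h, hC⟩ := mem_blockSupport.1 hx
  · exact Or.inl ⟨C, mem_blocksAt.2 ⟨h, hC⟩⟩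
  · exact Or.inr ⟨C, mem_blocksAt.2 ⟨h, hC⟩⟩

namespace IsBlockPair

theorem symm (h : IsBlockPair d T U) : IsBlockPair d U T where
  card_left := h.card_right
  card_right := h.card_left
  meet_left := h.meet_right
  meet_right := h.meet_left
  exists_not_common x hx := by
    obtain ⟨C, hC, h⟩ := h.exists_not_common x (blockSupport_comm (T := T) ▸ hx)
    exact ⟨C, hC, h.symm⟩

/-- If `A = B`, the only block at `x` would be common to both families, against `exists_not_common`.
-/
theorem ne_of_blocksAt_eq_singleton (h : IsBlockPair d T U) {A B : Finset V}
    (hA : blocksAt T x = {A}) (hB : blocksAt U x = {B}) : A ≠ B := by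
  rintro rfl
  have hA' := mem_of_blocksAt_eq_singleton hA
  have hB' := mem_of_blocksAt_eq_singleton hB
  obtain ⟨C, hxC, ⟨h1, h2⟩ | ⟨h1, h2⟩⟩ := h.exists_not_common x
    (mem_blockSupport.2 ⟨A, Or.inl hA'.1, hA'.2⟩)
  · have : C ∈ blocksAt T x := mem_blocksAt.2 ⟨h1, hxC⟩
    rw [hA, mem_singleton] at this
    exact h2 (this ▸ hB'.1)
  · have : C ∈ blocksAt U x := mem_blocksAt.2 ⟨h1, hxC⟩
    rw [hB, mem_singleton] at this
    exact h2 (this ▸ hA'.1)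

theorem card_sdiff_pos (h : IsBlockPair d T U) {A B : Finset V}
    (hA : blocksAt T x = {A}) (hB : blocksAt U x = {B}) : 0 < (B \ A).card := by
  rw [card_pos, sdiff_nonempty]
  intro hBA
  refine h.ne_of_blocksAt_eq_singleton hA hB (eq_of_subset_of_card_le hBA ?_).symm
  rw [h.card_left A (mem_of_blocksAt_eq_singleton hA).1,
    h.card_right B (mem_of_blocksAt_eq_singleton hB).1]

theorem card_sdiff_comm (h : IsBlockPair d T U) {A B : Finset V} (hA : A ∈ T) (hB : B ∈ U) :
    (A \ B).card = (B \ A).card :=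
  Finset.card_sdiff_comm ((h.card_left A hA).trans (h.card_right B hB).symm)

theorem two_mul_card_sdiff_le (h : IsBlockPair d T U) {A B : Finset V}
    (hA : blocksAt T x = {A}) (hB : blocksAt U x = {B}) :
    2 * (B \ A).card ≤ (symmNbrs T U x).card := by
  have hA' := mem_of_blocksAt_eq_singleton hA
  have hB' := mem_of_blocksAt_eq_singleton hB
  have hsub : A \ B ∪ B \ A ⊆ symmNbrs T U x := by
    intro y hy
    rw [mem_symmNbrs, blockNbrs_of_blocksAt_eq_singleton hA, blockNbrs_of_blocksAt_eq_singleton hB]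
    simp only [mem_union, mem_sdiff, mem_erase] at hy ⊢
    rcases hy with ⟨h1, h2⟩ | ⟨h1, h2⟩
    · exact Or.inl ⟨⟨fun e => h2 (e ▸ hB'.2), h1⟩, fun h => h2 h.2⟩
    · exact Or.inr ⟨⟨fun e => h2 (e ▸ hA'.2), h1⟩, fun h => h2 h.2⟩
  have := card_le_card hsub
  rw [card_union_of_disjoint disjoint_sdiff_sdiff, h.card_sdiff_comm hA'.1 hB'.1] at this
  omega

theorem pred_le_card_symmNbrs (h : IsBlockPair d T U) (hU : blocksAt U x = ∅)
    (hT : (blocksAt T x).Nonempty) : d - 1 ≤ (symmNbrs T U x).card := by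
  obtain ⟨C, hC⟩ := hT
  rw [mem_blocksAt] at hC
  rw [← h.card_left C hC.1, ← card_erase_of_mem hC.2]
  refine card_le_card fun y hy => ?_
  rw [mem_symmNbrs, blockNbrs_of_blocksAt_eq_empty hU, mem_blockNbrs]
  rw [mem_erase] at hy
  exact Or.inl ⟨⟨hy.1, C, hC.1, hC.2, hy.2⟩, notMem_empty _⟩

/-- If both families gave `x` the same neighbours, every block of `T` at `x` would lie in the unique
block of `U` there, hence equal it by size. -/
theorem card_symmNbrs_pos (h : IsBlockPair d T U) (hU : (blocksAt U x).card = 1)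
    (hT : 2 ≤ (blocksAt T x).card) : 0 < (symmNbrs T U x).card := by
  obtain ⟨B, hB⟩ := card_eq_one.1 hU
  have hB' := mem_of_blocksAt_eq_singleton hB
  obtain ⟨C, hC, D, hD, hne⟩ := one_lt_card.1 hT
  rw [mem_blocksAt] at hC hD
  rw [card_pos]
  by_contra hemp
  rw [not_nonempty_iff_eq_empty, symmNbrs, ← bot_eq_empty, symmDiff_eq_bot,
    blockNbrs_of_blocksAt_eq_singleton hB] at hemp
  have key : ∀ E ∈ T, x ∈ E → E = B := by
    intro E hE hxE
    refine eq_of_subset_of_card_le (fun y hy => ?_) ?_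
    · by_cases hyx : y = x
      · exact hyx ▸ hB'.2
      · have : y ∈ blockNbrs T x := mem_blockNbrs.2 ⟨hyx, E, hE, hxE, hy⟩
        rw [hemp] at this
        exact mem_of_mem_erase this
    · rw [h.card_left E hE, h.card_right B hB'.1]
  exact hne ((key C hC.1 hC.2).trans (key D hD.1 hD.2).symm)

end IsBlockPair

theorem sum_sum_blocksAt {W : Finset V} (hW : ∀ C ∈ T, C ⊆ W) (ch : Finset V → V → ℤ) :
    ∑ x ∈ W, ∑ C ∈ blocksAt T x, ch C x = ∑ C ∈ T, ∑ x ∈ C, ch C x := by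
  refine sum_comm' fun x C => ?_
  rw [mem_blocksAt]
  exact ⟨fun h => ⟨h.2.2, h.2.1⟩, fun h => ⟨hW C h.2 h.1, h.2, h.1⟩⟩

/-- Double counting: if blocks hand out at most `b` each, and every point of the support receives
at least `M` from its blocks and from a further supply `s`, then the support is small. -/
theorem card_blockSupport_le (ch : Finset V → V → ℤ) (b M : ℤ) (s : V → ℤ)
    (hb : ∀ C, C ∈ T ∨ C ∈ U → ∑ x ∈ C, ch C x ≤ b)
    (hM : ∀ x ∈ blockSupport T U,
      M ≤ ∑ C ∈ blocksAt T x, ch C x + ∑ C ∈ blocksAt U x, ch C x + s x) :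
    M * (blockSupport T U).card ≤
      (T.card + U.card : ℤ) * b + ∑ x ∈ blockSupport T U, s x := by
  have h1 := card_nsmul_le_sum _ _ _ hM
  rw [sum_add_distrib, sum_add_distrib, sum_sum_blocksAt, sum_sum_blocksAt] at h1
  · have h2 := sum_le_card_nsmul T (fun C => ∑ x ∈ C, ch C x) b fun C hC => hb C (Or.inl hC)
    have h3 := sum_le_card_nsmul U (fun C => ∑ x ∈ C, ch C x) b fun C hC => hb C (Or.inr hC)
    simp only [nsmul_eq_mul] at h1 h2 h3
    linarith
  · exact fun C hC x hx => mem_blockSupport.2 ⟨C, Or.inr hC, hx⟩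
  · exact fun C hC x hx => mem_blockSupport.2 ⟨C, Or.inl hC, hx⟩

end BlockPair

/-! ### Discharging: bounding the support by blocks and exceptional pairs -/

section Discharging

variable {V : Type*} [DecidableEq V] {d : ℕ} {T U : Finset (Finset V)} {x y : V}

theorem card_blocksAt_mul_le_sum {f : Finset V → ℤ} {c : ℤ} (hf : ∀ C ∈ T, x ∈ C → c ≤ f C) :
    (blocksAt T x).card * c ≤ ∑ C ∈ blocksAt T x, f C := by
  have := card_nsmul_le_sum (blocksAt T x) f c fun C hC =>
    hf C (mem_blocksAt.1 hC).1 (mem_blocksAt.1 hC).2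
  rwa [nsmul_eq_mul] at this

theorem le_sum_blocksAt {f : Finset V → ℤ} (hf : ∀ C, 0 ≤ f C) {C : Finset V} (hC : C ∈ T)
    (hx : x ∈ C) : f C ≤ ∑ C ∈ blocksAt T x, f C :=
  single_le_sum (fun C _ => hf C) (mem_blocksAt.2 ⟨hC, hx⟩)

/-- The point `x` lies in blocks of only one of the two families. -/
def IsSingle (T U : Finset (Finset V)) (x : V) : Prop := blocksAt T x = ∅ ∨ blocksAt U x = ∅

/-- A point `x` that lies in a single block of each family, the two blocks being almost equal. -/
def IsTight (d : ℕ) (T U : Finset (Finset V)) (x : V) : Prop :=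
  ∃ A B, blocksAt T x = {A} ∧ blocksAt U x = {B} ∧ 3 * (B \ A).card + 2 < d

theorem not_isSingle_of_mem {C D : Finset V} (hC : C ∈ T) (hD : D ∈ U) (hxC : x ∈ C)
    (hxD : x ∈ D) : ¬ IsSingle T U x := by
  rintro (h | h)
  · exact notMem_empty C (h ▸ mem_blocksAt.2 ⟨hC, hxC⟩)
  · exact notMem_empty D (h ▸ mem_blocksAt.2 ⟨hD, hxD⟩)

namespace IsBlockPair

/-- The cases of every discharging argument below: a point in few blocks must make up for it with
pairs joined by one family only. -/
theorem degree_cases (h : IsBlockPair d T U) (hx : x ∈ blockSupport T U) :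
    (IsSingle T U x ∧ 1 ≤ (blocksAt T x).card + (blocksAt U x).card ∧
      d - 1 ≤ (symmNbrs T U x).card) ∨
    (¬ IsSingle T U x ∧
      ((∃ A B, blocksAt T x = {A} ∧ blocksAt U x = {B}) ∨
      (3 ≤ (blocksAt T x).card + (blocksAt U x).card ∧ 1 ≤ (symmNbrs T U x).card) ∨
      4 ≤ (blocksAt T x).card + (blocksAt U x).card)) := by
  by_cases hs : IsSingle T U x
  · refine Or.inl ⟨hs, ?_⟩
    have hne := blocksAt_nonempty_or hx
    rcases hs with hT | hU
    · have hU : (blocksAt U x).Nonempty := by simpa [hT] using hne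
      have := h.symm.pred_le_card_symmNbrs hT hU
      rw [symmNbrs_comm] at this
      have := hU.card_pos
      omega
    · have hT : (blocksAt T x).Nonempty := by simpa [hU] using hne
      have := h.pred_le_card_symmNbrs hU hT
      have := hT.card_pos
      omega
  · refine Or.inr ⟨hs, ?_⟩
    rw [IsSingle, not_or, ← ne_eq, ← ne_eq, ← nonempty_iff_ne_empty, ← nonempty_iff_ne_empty,
      ← card_pos, ← card_pos] at hs
    by_cases h1 : (blocksAt T x).card = 1
    · by_cases h2 : (blocksAt U x).card = 1
      · obtain ⟨A, hA⟩ := card_eq_one.1 h1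
        obtain ⟨B, hB⟩ := card_eq_one.1 h2
        exact Or.inl ⟨A, B, hA, hB⟩
      · have := h.symm.card_symmNbrs_pos h1 (by omega)
        rw [symmNbrs_comm] at this
        omega
    · by_cases h2 : (blocksAt U x).card = 1
      · have := h.card_symmNbrs_pos h2 (by omega)
        omega
      · omega

/-- A block has at least two points that are not single. -/
theorem card_filter_isSingle_le (h : IsBlockPair d T U) [DecidablePred (IsSingle T U)]
    {C : Finset V} (hC : C ∈ T ∨ C ∈ U) : (C.filter (IsSingle T U)).card + 2 ≤ d := by
  obtain ⟨D, hD, hcard⟩ : ∃ D, (∀ x ∈ C, x ∈ D → ¬ IsSingle T U x) ∧ 2 ≤ (C ∩ D).card := by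
    rcases hC with hC | hC
    · obtain ⟨D, hD, h2⟩ := h.meet_left C hC
      exact ⟨D, fun x h1 h2 => not_isSingle_of_mem hC hD h1 h2, h2⟩
    · obtain ⟨D, hD, h2⟩ := h.meet_right C hC
      exact ⟨D, fun x h1 h2 => not_isSingle_of_mem hD hC h2 h1, h2⟩
  have hCd : C.card = d := hC.elim (h.card_left C) (h.card_right C)
  have hdisj : Disjoint (C.filter (IsSingle T U)) (C ∩ D) := by
    rw [disjoint_left]
    intro x h1 h2
    rw [mem_filter] at h1
    exact hD x h1.1 (mem_inter.1 h2).2 h1.2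
  have := card_le_card (union_subset (filter_subset (IsSingle T U) C) (inter_subset_left (s₂ := D)))
  rw [card_union_of_disjoint hdisj] at this
  omega

theorem mem_symmNbrs_of_isSingle {C : Finset V} (hC : C ∈ T ∨ C ∈ U) (hx : x ∈ C) (hy : y ∈ C)
    (hxy : x ≠ y) (hs : IsSingle T U y) : y ∈ symmNbrs T U x := by
  rw [mem_symmNbrs_comm, mem_symmNbrs]
  have hne : ∀ {S}, C ∈ S → x ∈ blockNbrs S y := fun hS =>
    mem_blockNbrs.2 ⟨hxy, C, hS, hy, hx⟩
  have hemp : ∀ {S}, C ∈ S → blocksAt S y ≠ ∅ := fun hS h0 =>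
    notMem_empty C (h0 ▸ mem_blocksAt.2 ⟨hS, hy⟩)
  rcases hC with hC | hC
  · rcases hs with hs | hs
    · exact absurd hs (hemp hC)
    · exact Or.inl ⟨hne hC, by simp [blockNbrs_of_blocksAt_eq_empty hs]⟩
  · rcases hs with hs | hs
    · exact Or.inr ⟨hne hC, by simp [blockNbrs_of_blocksAt_eq_empty hs]⟩
    · exact absurd hs (hemp hC)

theorem exists_block_of_mem_symmNbrs (hy : y ∈ symmNbrs T U x) :
    ∃ C, (C ∈ T ∨ C ∈ U) ∧ x ∈ C ∧ y ∈ C ∧ y ≠ x := by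
  rw [mem_symmNbrs, mem_blockNbrs, mem_blockNbrs] at hy
  rcases hy with ⟨⟨h, C, hC, h1, h2⟩, -⟩ | ⟨⟨h, C, hC, h1, h2⟩, -⟩
  · exact ⟨C, Or.inl hC, h1, h2, h⟩
  · exact ⟨C, Or.inr hC, h1, h2, h⟩

/-- Scaled by 3: every point needs 60, each block gives 16 to each of its points, and each pair in
`symmNbrs` carries 36, split unevenly between its ends. Single points meet the need as `16 + 2 *
22`, points in one block of each family as `2 * 16 + 2 * 14`. -/
theorem card_blockSupport_le_three (h : IsBlockPair 3 T U) :
    (20 : ℤ) * (blockSupport T U).card ≤ (T.card + U.card : ℤ) * 16 +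
      6 * ∑ x ∈ blockSupport T U, ((symmNbrs T U x).card : ℤ) := by
  classical
  -- Single points may take more than half of 36 because two of them never share a block: a triple
  -- has at most one.
  let wt : V → ℤ := fun x => if IsSingle T U x then 22 else 14
  have hwt : ∀ x ∈ blockSupport T U, ∀ y ∈ symmNbrs T U x, wt x + wt y ≤ 36 := by
    intro x _ y hy
    obtain ⟨C, hC, hxC, hyC, hyx⟩ := exists_block_of_mem_symmNbrs hy
    by_cases hx : IsSingle T U x
    · by_cases hy : IsSingle T U y
      · have h1 := h.card_filter_isSingle_le hC
        have h2 : ({x, y} : Finset V) ⊆ C.filter (IsSingle T U) := by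
          intro z hz
          rw [mem_insert, mem_singleton] at hz
          rcases hz with rfl | rfl <;> simp [*]
        have h3 := card_le_card h2
        rw [card_pair hyx.symm] at h3
        omega
      · simp [wt, hx, hy]
    · by_cases hy : IsSingle T U y <;> simp [wt, hx, hy]
  have hswap : ∑ x ∈ blockSupport T U, ∑ y ∈ symmNbrs T U x, wt y =
      ∑ x ∈ blockSupport T U, ∑ y ∈ symmNbrs T U x, wt x := by
    refine sum_comm' fun x y => ?_
    rw [mem_symmNbrs_comm]
    exact ⟨fun h => ⟨h.2, symmNbrs_subset_blockSupport (mem_symmNbrs_comm.1 h.2)⟩,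
      fun h => ⟨symmNbrs_subset_blockSupport h.1, h.1⟩⟩
  have hsum : 2 * ∑ x ∈ blockSupport T U, ∑ y ∈ symmNbrs T U x, wt x ≤
      36 * ∑ x ∈ blockSupport T U, ((symmNbrs T U x).card : ℤ) := by
    have : ∑ x ∈ blockSupport T U, ∑ y ∈ symmNbrs T U x, (wt x + wt y) ≤
        ∑ x ∈ blockSupport T U, ∑ _y ∈ symmNbrs T U x, (36 : ℤ) :=
      sum_le_sum fun x hx => sum_le_sum fun y hy => hwt x hx y hy
    simp only [sum_add_distrib, hswap] at this
    simp only [sum_const, nsmul_eq_mul, ← sum_mul] at this ⊢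
    linarith
  have := card_blockSupport_le (T := T) (U := U) (fun _ _ => (16 : ℤ)) 48 60
    (fun x => ∑ y ∈ symmNbrs T U x, wt x) ?_ ?_
  · linarith
  · intro C hC
    have : C.card = 3 := hC.elim (h.card_left C) (h.card_right C)
    simp [this]
  · intro x hx
    simp only [sum_const, nsmul_eq_mul]
    rcases h.degree_cases hx with ⟨hs, h1, h2⟩ | ⟨hs, h1⟩
    · simp only [wt, hs, if_true]
      omega
    · simp only [wt, hs, if_false]
      rcases h1 with ⟨A, B, hA, hB⟩ | h1 | h1
      · have h2 := h.two_mul_card_sdiff_le hA hB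
        have h3 := h.card_sdiff_pos hA hB
        rw [hA, hB, card_singleton, card_singleton]
        omega
      · omega
      · omega

theorem card_blockSupport_le_four (h : IsBlockPair 4 T U) :
    (28 : ℤ) * (blockSupport T U).card ≤ (T.card + U.card : ℤ) * 34 +
      6 * ∑ x ∈ blockSupport T U, ((symmNbrs T U x).card : ℤ) := by
  classical
  let c : Finset V → ℕ := fun C => (C.filter (IsSingle T U)).card
  -- A block has at most two single points, and `2 * 10 + 2 * 7 = 10 + 3 * 8 = 34` exhausts its
  -- budget. A point needs 28, that is `10 + 6 * 3` if single and `2 * 8 + 6 * 2` in the basic case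
  -- with one block of each family.
  let ch : Finset V → V → ℤ := fun C x =>
    if IsSingle T U x then 10 else if c C = 2 then 7 else 8
  rw [mul_sum]
  refine card_blockSupport_le ch 34 28 _ ?_ ?_
  · intro C hC
    have hcard : C.card = 4 := hC.elim (h.card_left C) (h.card_right C)
    have h1 := h.card_filter_isSingle_le hC
    have h2 := card_filter_add_card_filter_not (s := C) (IsSingle T U)
    simp only [ch, sum_ite (s := C) (p := IsSingle T U), sum_const, nsmul_eq_mul]
    have h3 : c C = (C.filter (IsSingle T U)).card := rfl
    rw [← h3] at h1 h2 ⊢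
    split_ifs <;> omega
  · intro x hx
    rcases h.degree_cases hx with ⟨hs, h1, h2⟩ | ⟨hs, h1⟩
    · simp only [ch, hs, if_true, sum_const, nsmul_eq_mul]
      omega
    · simp only [ch, hs, if_false]
      by_cases hc : ∃ C, (C ∈ T ∨ C ∈ U) ∧ x ∈ C ∧ c C = 2
      · obtain ⟨C, hC, hxC, hc⟩ := hc
        have hT : (blocksAt T x).card * 7 ≤ ∑ C ∈ blocksAt T x, if c C = 2 then (7 : ℤ) else 8 :=
          card_blocksAt_mul_le_sum fun C _ _ => by split_ifs <;> norm_num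
        have hU : (blocksAt U x).card * 7 ≤ ∑ C ∈ blocksAt U x, if c C = 2 then (7 : ℤ) else 8 :=
          card_blocksAt_mul_le_sum fun C _ _ => by split_ifs <;> norm_num
        have hsub : C.filter (IsSingle T U) ⊆ symmNbrs T U x := by
          intro y hy
          rw [mem_filter] at hy
          exact mem_symmNbrs_of_isSingle hC hxC hy.1 (fun e => hs (e ▸ hy.2)) hy.2
        have hn := card_le_card hsub
        have h3 : c C = (C.filter (IsSingle T U)).card := rfl
        rcases h1 with ⟨A, B, hA, hB⟩ | h1 | h1
        · have h4 := h.two_mul_card_sdiff_le hA hB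
          -- The reduced share 7 is made up for here: the two single points of `C` lie outside the
          -- block of the other family.
          have h5 : 2 ≤ (B \ A).card := by
            have hA' := mem_of_blocksAt_eq_singleton hA
            have hB' := mem_of_blocksAt_eq_singleton hB
            rcases hC with hC | hC
            · have hCA : C = A := by
                have : C ∈ blocksAt T x := mem_blocksAt.2 ⟨hC, hxC⟩
                rwa [hA, mem_singleton] at this
              rw [← h.card_sdiff_comm hA'.1 hB'.1, ← hc, h3, hCA]
              refine card_le_card fun y hy => ?_
              rw [mem_filter] at hy
              exact mem_sdiff.2 ⟨hy.1, fun hyB => not_isSingle_of_mem hA'.1 hB'.1 hy.1 hyB hy.2⟩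
            · have hCB : C = B := by
                have : C ∈ blocksAt U x := mem_blocksAt.2 ⟨hC, hxC⟩
                rwa [hB, mem_singleton] at this
              rw [← hc, h3, hCB]
              refine card_le_card fun y hy => ?_
              rw [mem_filter] at hy
              exact mem_sdiff.2 ⟨hy.1, fun hyA => not_isSingle_of_mem hA'.1 hB'.1 hyA hy.1 hy.2⟩
          rw [hA, card_singleton] at hT
          rw [hB, card_singleton] at hU
          rw [hA, hB]
          omega
        · omega
        · omega
      · have hT : (blocksAt T x).card * 8 ≤ ∑ C ∈ blocksAt T x, if c C = 2 then (7 : ℤ) else 8 :=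
          card_blocksAt_mul_le_sum fun C h1 h2 => by
            rw [if_neg fun h3 => hc ⟨C, Or.inl h1, h2, h3⟩]
        have hU : (blocksAt U x).card * 8 ≤ ∑ C ∈ blocksAt U x, if c C = 2 then (7 : ℤ) else 8 :=
          card_blocksAt_mul_le_sum fun C h1 h2 => by
            rw [if_neg fun h3 => hc ⟨C, Or.inr h1, h2, h3⟩]
        rcases h1 with ⟨A, B, hA, hB⟩ | h1 | h1
        · have h2 := h.two_mul_card_sdiff_le hA hB
          have h3 := h.card_sdiff_pos hA hB
          rw [hA, card_singleton] at hT
          rw [hB, card_singleton] at hU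
          rw [hA, hB]
          omega
        · omega
        · omega

theorem isTight_comm (h : IsBlockPair d T U) : IsTight d T U x ↔ IsTight d U T x := by
  have key : ∀ {S R : Finset (Finset V)}, IsBlockPair d S R → IsTight d S R x → IsTight d R S x := by
    rintro S R h ⟨A, B, hA, hB, h3⟩
    refine ⟨B, A, hB, hA, ?_⟩
    rwa [h.card_sdiff_comm (mem_of_blocksAt_eq_singleton hA).1 (mem_of_blocksAt_eq_singleton hB).1]
  exact ⟨key h, key h.symm⟩

/-- A block with at least `d - 1` tight points is almost a block `A` of the other family: the tight
points all share the same `A`, and the one remaining point is outside `A`. -/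
theorem exists_of_tight_block (h : IsBlockPair d T U) (hd : 3 ≤ d) {R B : Finset V} (hB : B ∈ U)
    (hRB : R ⊆ B) (hR : ∀ x ∈ R, IsTight d T U x) (hcard : d ≤ R.card + 1) :
    ∃ A ∈ T, ∃ y ∈ B, y ∉ A ∧ R = B.erase y ∧ ∀ x ∈ R, blocksAt T x = {A} := by
  have hR' : ∀ x ∈ R, ∃ A, blocksAt T x = {A} ∧ blocksAt U x = {B} ∧
      3 * (B \ A).card + 2 < d := by
    intro x hx
    obtain ⟨A, B', hA, hB', h3⟩ := hR x hx
    have : B ∈ blocksAt U x := mem_blocksAt.2 ⟨hB, hRB hx⟩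
    rw [hB', mem_singleton] at this
    exact ⟨A, hA, this ▸ hB', this ▸ h3⟩
  obtain ⟨v, hv⟩ : R.Nonempty := card_pos.1 (by omega)
  obtain ⟨A, hA, hUv, hvA⟩ := hR' v hv
  have hall : ∀ x ∈ R, blocksAt T x = {A} := by
    intro x hx
    obtain ⟨A', hA', -, hxA⟩ := hR' x hx
    by_contra hne
    have hAA : A' ≠ A := fun e => hne (e ▸ hA')
    -- A point of `R` in both `A` and `A'` would lie in two blocks of `T`. But the two differences
    -- together have fewer than `2(d - 2)/3` points.
    have hsub : R ⊆ (B \ A) ∪ (B \ A') := by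
      intro z hz
      obtain ⟨D, hD, -, -⟩ := hR' z hz
      by_contra hzn
      have hzB := hRB hz
      simp only [mem_union, mem_sdiff, hzB, true_and, not_or, not_not] at hzn
      have h1 : A ∈ blocksAt T z := mem_blocksAt.2 ⟨(mem_of_blocksAt_eq_singleton hA).1, hzn.1⟩
      have h2 : A' ∈ blocksAt T z := mem_blocksAt.2 ⟨(mem_of_blocksAt_eq_singleton hA').1, hzn.2⟩
      rw [hD, mem_singleton] at h1 h2
      exact hAA (h2.trans h1.symm)
    have := (card_le_card hsub).trans (card_union_le _ _)
    omega
  obtain ⟨y, hy⟩ := card_pos.1 (h.card_sdiff_pos hA hUv)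
  rw [mem_sdiff] at hy
  refine ⟨A, (mem_of_blocksAt_eq_singleton hA).1, y, hy.1, hy.2, ?_, hall⟩
  refine eq_of_subset_of_card_le (fun x hx => mem_erase.2 ⟨?_, hRB hx⟩) ?_
  · rintro rfl
    exact hy.2 (mem_of_blocksAt_eq_singleton (hall x hx)).2
  · rw [card_erase_of_mem hy.1, h.card_right B hB]
    omega

/-- The exceptional point of such a block is joined to all the tight ones by `B`, but not by their
only block `A` of `T`. This pays for its smaller share in the discharging. -/
theorem pred_le_card_symmNbrs_of_tight_block (h : IsBlockPair d T U) (hd : 3 ≤ d)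
    {R B : Finset V} (hB : B ∈ U) (hRB : R ⊆ B) (hR : ∀ x ∈ R, IsTight d T U x)
    (hcard : d ≤ R.card + 1) (hx : x ∈ B) (hxR : x ∉ R) : d - 1 ≤ (symmNbrs T U x).card := by
  obtain ⟨A, hA, y, hy, hyA, hRy, hall⟩ := h.exists_of_tight_block hd hB hRB hR hcard
  have hxy : x = y := by
    by_contra hne
    exact hxR (hRy ▸ mem_erase.2 ⟨hne, hx⟩)
  subst hxy
  have hsub : R ⊆ symmNbrs T U x := by
    intro z hz
    have hzB := hRB hz
    rw [mem_symmNbrs_comm, mem_symmNbrs, blockNbrs_of_blocksAt_eq_singleton (hall z hz),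
      mem_blockNbrs]
    exact Or.inr ⟨⟨fun e => hxR (e ▸ hz), B, hB, hzB, hx⟩, fun h => hyA (mem_of_mem_erase h)⟩
  have := card_le_card hsub
  omega

theorem card_blockSupport_le_of_five_le (h : IsBlockPair d T U) (hd : 5 ≤ d) :
    (8 * d - 4 : ℤ) * (blockSupport T U).card ≤
      (T.card + U.card : ℤ) * (4 * d ^ 2 - 10 * d + 10) +
      6 * ∑ x ∈ blockSupport T U, ((symmNbrs T U x).card : ℤ) := by
  classical
  have hd' : (5 : ℤ) ≤ d := by exact_mod_cast hd
  let R : Finset V → Finset V := fun C => C.filter (IsTight d T U)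
  -- A tight point has as few as two exceptional pairs, so it needs `4(d-2)` from both its blocks:
  -- `8(d-2) + 12 = 8d - 4`. The other two values exhaust the budget: `(d-1) * 4(d-2) + 2(d+1)` and
  -- `(d-2) * 4(d-2) + 2 * 3(d-1)` both equal `4d² - 10d + 10`.
  let ch : Finset V → V → ℤ := fun C x =>
    if IsTight d T U x then 4 * (d - 2) else if d ≤ (R C).card + 1 then 2 * (d + 1) else 3 * (d - 1)
  have hRsub : ∀ C, R C ⊆ C := fun C => filter_subset _ C
  have hRt : ∀ C, ∀ x ∈ R C, IsTight d T U x := fun C x hx => (mem_filter.1 hx).2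
  have hRt' : ∀ C, ∀ x ∈ R C, IsTight d U T x := fun C x hx => h.isTight_comm.1 (hRt C x hx)
  have hch : ∀ C x, 2 * (d + 1) ≤ ch C x := by
    intro C x
    simp only [ch]
    split_ifs <;> linarith
  rw [mul_sum]
  refine card_blockSupport_le ch _ _ _ ?_ ?_
  · intro C hC
    have hcard : C.card = d := hC.elim (h.card_left C) (h.card_right C)
    have h2 := card_filter_add_card_filter_not (s := C) (IsTight d T U)
    have h3 : (R C).card = (C.filter (IsTight d T U)).card := rfl
    simp only [ch, sum_ite (s := C) (p := IsTight d T U), sum_const, nsmul_eq_mul]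
    rw [hcard, ← h3] at h2
    rw [← h3]
    split_ifs with hk
    · have hlt : (R C).card + 1 = d := by
        rcases hC with hC | hC
        · obtain ⟨A, -, y, hy, -, hRy, -⟩ :=
            h.symm.exists_of_tight_block (by omega) hC (hRsub C) (hRt' C) hk
          rw [hRy, card_erase_of_mem hy, hcard]
          omega
        · obtain ⟨A, -, y, hy, -, hRy, -⟩ :=
            h.exists_of_tight_block (by omega) hC (hRsub C) (hRt C) hk
          rw [hRy, card_erase_of_mem hy, hcard]
          omega
      have e1 : (C.filter fun x => ¬ IsTight d T U x).card = 1 := by omega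
      have e2 : ((R C).card : ℤ) = d - 1 := by omega
      rw [e1, e2]
      push_cast
      nlinarith
    · have e1 : ((C.filter fun x => ¬ IsTight d T U x).card : ℤ) = d - (R C).card := by omega
      have e2 : ((R C).card : ℤ) ≤ d - 2 := by omega
      rw [e1]
      nlinarith [mul_nonneg (sub_nonneg.2 hd') (sub_nonneg.2 e2)]
  · intro x hx
    by_cases ht : IsTight d T U x
    · obtain ⟨A, B, hA, hB, -⟩ := id ht
      have h2 := h.two_mul_card_sdiff_le hA hB
      have h3 := h.card_sdiff_pos hA hB
      simp only [ch, ht, if_true, hA, hB, sum_singleton]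
      omega
    · by_cases hc : ∃ C, (C ∈ T ∨ C ∈ U) ∧ x ∈ C ∧ d ≤ (R C).card + 1
      · obtain ⟨C, hC, hxC, hk⟩ := hc
        -- Here `x` is the exceptional point of an almost tight block, and `2(d+1) + 6(d-1)` is
        -- exactly `8d - 4`.
        have hxR : x ∉ R C := fun h => ht (hRt C x h)
        have h0 : ∀ C, 0 ≤ ch C x := fun C => by linarith [hch C x]
        have hT0 : 0 ≤ ∑ C ∈ blocksAt T x, ch C x := sum_nonneg fun C _ => h0 C
        have hU0 : 0 ≤ ∑ C ∈ blocksAt U x, ch C x := sum_nonneg fun C _ => h0 C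
        have hCx := hch C x
        rcases hC with hC | hC
        · have h1 := le_sum_blocksAt h0 hC hxC
          have h2 := h.symm.pred_le_card_symmNbrs_of_tight_block (by omega) hC (hRsub C) (hRt' C)
            hk hxC hxR
          rw [symmNbrs_comm] at h2
          omega
        · have h1 := le_sum_blocksAt h0 hC hxC
          have h2 := h.pred_le_card_symmNbrs_of_tight_block (by omega) hC (hRsub C) (hRt C)
            hk hxC hxR
          omega
      · have hT : (blocksAt T x).card * (3 * (d - 1) : ℤ) ≤ ∑ C ∈ blocksAt T x, ch C x :=
          card_blocksAt_mul_le_sum fun C h1 h2 => by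
            simp only [ch, ht, if_false]
            rw [if_neg fun h3 => hc ⟨C, Or.inl h1, h2, h3⟩]
        have hU : (blocksAt U x).card * (3 * (d - 1) : ℤ) ≤ ∑ C ∈ blocksAt U x, ch C x :=
          card_blocksAt_mul_le_sum fun C h1 h2 => by
            simp only [ch, ht, if_false]
            rw [if_neg fun h3 => hc ⟨C, Or.inr h1, h2, h3⟩]
        have key : ∀ r : ℤ, r ≤ (blocksAt T x).card + (blocksAt U x).card →
            r * (3 * (d - 1)) ≤ ∑ C ∈ blocksAt T x, ch C x + ∑ C ∈ blocksAt U x, ch C x := by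
          intro r hr
          have := mul_le_mul_of_nonneg_right hr (by linarith : (0 : ℤ) ≤ 3 * (d - 1))
          linarith
        -- The cases receive at least `9(d-1)`, `6(d-1) + 4(d-2)`, and `9(d-1)` from three or more
        -- blocks; these reach `8d - 4` precisely when `d ≥ 5`.
        rcases h.degree_cases hx with ⟨-, h1, h2⟩ | ⟨-, ⟨A, B, hA, hB⟩ | ⟨h1, -⟩ | h1⟩
        · have := key 1 (by omega)
          omega
        · have h2 := h.two_mul_card_sdiff_le hA hB
          have h3 : d ≤ 3 * (B \ A).card + 2 := by
            by_contra hlt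
            exact ht ⟨A, B, hA, hB, by omega⟩
          have := key 2 (by simp [hA, hB])
          omega
        · have := key 3 (by omega)
          omega
        · have := key 3 (by omega)
          omega

theorem card_blockSupport_le (h : IsBlockPair d T U) (hd : 3 ≤ d) :
    (8 * d - 4 : ℤ) * (blockSupport T U).card ≤
      (T.card + U.card : ℤ) * (4 * d ^ 2 - 10 * d + 10) +
      6 * ∑ x ∈ blockSupport T U, ((symmNbrs T U x).card : ℤ) := by
  obtain rfl | rfl | h5 : d = 3 ∨ d = 4 ∨ 5 ≤ d := by omega
  · simpa using h.card_blockSupport_le_three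
  · simpa using h.card_blockSupport_le_four
  · exact h.card_blockSupport_le_of_five_le h5

end IsBlockPair

end Discharging

/-! ### From a second preimage to a dense subhypergraph -/

namespace UniformHypergraph

variable {V : Type*} {d : ℕ}

theorem le_maxRatio_of_exists_sub [Finite V] (hd : 3 ≤ d) (h : UniformHypergraph d V)
    (hK : ∃ K : h.Sub,
      (2 * d - 1 : ℤ) * K.verts.card ≤ (2 * d ^ 2 - 5 * d + 5) * K.edges.card) :
    (2 * d - 1 : ℝ) / (2 * d ^ 2 - 5 * d + 5) ≤ h.maxRatio := by
  obtain ⟨K, hK⟩ := hK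
  have hd' : (3 : ℝ) ≤ d := by exact_mod_cast hd
  have hK' : (2 * d - 1 : ℝ) * K.verts.card ≤ (2 * d ^ 2 - 5 * d + 5) * K.edges.card := by
    exact_mod_cast hK
  have hv : (0 : ℝ) < K.verts.card := by exact_mod_cast K.nonempty.card_pos
  have hq : (0 : ℝ) < 2 * d ^ 2 - 5 * d + 5 := by nlinarith
  refine le_trans ?_ (le_ciSup (f := fun K : h.Sub => K.ratio) (Set.finite_range _).bddAbove K)
  rw [Sub.ratio, div_le_div_iff₀ hq hv]
  linarith

theorem threshold_eq (hd : 3 ≤ d) :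
    (2 * (d : ℝ) - 4) / (2 * (d : ℝ) - 1) =
      d - 1 - 1 / ((2 * d - 1) / (2 * d ^ 2 - 5 * d + 5)) := by
  have hd' : (3 : ℝ) ≤ d := by exact_mod_cast hd
  have hp : (2 * d - 1 : ℝ) ≠ 0 := by linarith
  rw [one_div_div]
  field_simp
  ring

theorem exists_mem_of_proj_eq {h H : UniformHypergraph d V} (hproj : H.proj = h.proj) {x y : V}
    (hxy : x ≠ y) {e : Finset V} (he : e ∈ H.edges) (hx : x ∈ e) (hy : y ∈ e) :
    ∃ e' ∈ h.edges, x ∈ e' ∧ y ∈ e' := by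
  have : H.proj.Adj x y := ⟨hxy, e, he, hx, hy⟩
  rw [hproj] at this
  exact this.2

section

variable [DecidableEq V]

/-- Enlarge `W` by every edge that meets it in `k ≥ 2` points. Such an edge adds at most `d - k`
vertices, so its net gain is `(2d²-5d+5) - (2d-1)(d-k) = (2d-1)(k-2) + 3`. -/
theorem exists_sub_of_sum_le (h : UniformHypergraph d V) {W : Finset V}
    (hW : W.Nonempty) (hd : 1 ≤ d)
    (hsum : (2 * d - 1 : ℤ) * W.card ≤ ∑ e ∈ h.edges.filter (fun e => 2 ≤ (e ∩ W).card),
      ((2 * d - 1) * ((e ∩ W).card - 2) + 3 : ℤ)) :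
    ∃ K : h.Sub, (2 * d - 1 : ℤ) * K.verts.card ≤ (2 * d ^ 2 - 5 * d + 5) * K.edges.card := by
  set F := h.edges.filter (fun e => 2 ≤ (e ∩ W).card) with hF
  refine ⟨⟨W ∪ F.biUnion (· \ W), F, hW.mono subset_union_left, filter_subset _ _,
    fun e he x hx => ?_⟩, ?_⟩
  · by_cases hxW : x ∈ W
    · exact mem_union_left _ hxW
    · exact mem_union_right _ (mem_biUnion.2 ⟨e, he, mem_sdiff.2 ⟨hx, hxW⟩⟩)
  · have h1 : ((W ∪ F.biUnion (· \ W)).card : ℤ) ≤ W.card + ∑ e ∈ F, (d - (e ∩ W).card : ℤ) := by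
      have h2 : (W ∪ F.biUnion (· \ W)).card ≤ W.card + ∑ e ∈ F, (e \ W).card :=
        (card_union_le _ _).trans (Nat.add_le_add_left card_biUnion_le _)
      have h3 : ∑ e ∈ F, (d - (e ∩ W).card : ℤ) = ∑ e ∈ F, ((e \ W).card : ℤ) := by
        refine sum_congr rfl fun e he => ?_
        have := card_sdiff_add_card_inter e W
        rw [h.uniform e (mem_filter.1 he).1] at this
        omega
      rw [h3]
      exact_mod_cast h2
    have h4 : (0 : ℤ) ≤ 2 * d - 1 := by omega
    calc (2 * d - 1 : ℤ) * (W ∪ F.biUnion (· \ W)).card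
        ≤ (2 * d - 1) * (W.card + ∑ e ∈ F, (d - (e ∩ W).card : ℤ)) :=
          mul_le_mul_of_nonneg_left h1 h4
      _ ≤ ∑ e ∈ F, ((2 * d - 1) * ((e ∩ W).card - 2) + 3 : ℤ) +
          ∑ e ∈ F, (2 * d - 1) * (d - (e ∩ W).card : ℤ) := by
          rw [mul_add, mul_sum]
          linarith
      _ = (2 * d ^ 2 - 5 * d + 5) * F.card := by
          rw [← sum_add_distrib, mul_comm _ (F.card : ℤ), ← nsmul_eq_mul, ← sum_const]
          exact sum_congr rfl fun e _ => by ring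

/-- A small vertex set `W` with many inner edges, and many pairs covered by edges that leave `W`,
yields a dense subhypergraph. -/
theorem exists_sub_of_pairs (h : UniformHypergraph d V) {W : Finset V}
    (hW : W.Nonempty) (hd : 3 ≤ d) (S : V → Finset V)
    (hS : ∀ x ∈ W, ∀ y ∈ S x, y ∈ W ∧ y ≠ x ∧ ∃ e ∈ h.edges, ¬ e ⊆ W ∧ x ∈ e ∧ y ∈ e)
    (hsum : (4 * d - 2 : ℤ) * W.card ≤
      (h.edges.filter (· ⊆ W)).card * (4 * d ^ 2 - 10 * d + 10) + 3 * ∑ x ∈ W, ((S x).card : ℤ)) :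
    ∃ K : h.Sub, (2 * d - 1 : ℤ) * K.verts.card ≤ (2 * d ^ 2 - 5 * d + 5) * K.edges.card := by
  refine h.exists_sub_of_sum_le hW (by omega) ?_
  set F' := h.edges.filter (fun e => ¬ e ⊆ W ∧ 2 ≤ (e ∩ W).card) with hF'
  have hsplit : h.edges.filter (fun e => 2 ≤ (e ∩ W).card) = h.edges.filter (· ⊆ W) ∪ F' := by
    ext e
    simp only [mem_filter, mem_union, hF']
    by_cases he : e ⊆ W
    · simp only [he, and_true, not_true, false_and, and_false, or_false,
        and_iff_left_iff_imp]
      intro h1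
      rw [inter_eq_left.2 he, h.uniform e h1]
      omega
    · simp [he]
  have hdisj : Disjoint (h.edges.filter (· ⊆ W)) F' := by
    rw [disjoint_left]
    intro e h1 h2
    exact (mem_filter.1 h2).2.1 (mem_filter.1 h1).2
  have hpairs : ∑ x ∈ W, ((S x).card : ℤ) ≤
      ∑ e ∈ F', ((e ∩ W).card * ((e ∩ W).card - 1) : ℤ) := by
    have h1 : ∀ x ∈ W, ((S x).card : ℤ) ≤ ∑ e ∈ F'.filter (x ∈ ·), ((e ∩ W).card - 1 : ℤ) := by
      intro x hx
      have hsub : S x ⊆ (F'.filter (x ∈ ·)).biUnion fun e => (e ∩ W).erase x := by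
        intro y hy
        obtain ⟨hyW, hyx, e, he, heW, hxe, hye⟩ := hS x hx y hy
        rw [mem_biUnion]
        refine ⟨e, ?_, mem_erase.2 ⟨hyx, mem_inter.2 ⟨hye, hyW⟩⟩⟩
        rw [mem_filter, hF', mem_filter]
        refine ⟨⟨he, heW, one_lt_card.2 ⟨x, mem_inter.2 ⟨hxe, hx⟩, y, mem_inter.2 ⟨hye, hyW⟩,
          hyx.symm⟩⟩, hxe⟩
      have h2 := (card_le_card hsub).trans card_biUnion_le
      have h3 : ∑ e ∈ F'.filter (x ∈ ·), ((e ∩ W).card - 1 : ℤ) =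
          ∑ e ∈ F'.filter (x ∈ ·), (((e ∩ W).erase x).card : ℤ) := by
        refine sum_congr rfl fun e he => ?_
        have hxe : x ∈ e ∩ W := mem_inter.2 ⟨(mem_filter.1 he).2, hx⟩
        rw [card_erase_of_mem hxe, Nat.cast_sub (card_pos.2 ⟨x, hxe⟩)]
        simp
      rw [h3]
      exact_mod_cast h2
    refine (sum_le_sum h1).trans (le_of_eq ?_)
    rw [sum_comm' (t' := F') (s' := fun e => e ∩ W)]
    · exact sum_congr rfl fun e _ => by rw [sum_const, nsmul_eq_mul]
    · intro x e
      simp only [mem_filter, mem_inter]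
      tauto
  have hF : ∑ e ∈ F', 3 * ((e ∩ W).card * ((e ∩ W).card - 1) : ℤ) ≤
      ∑ e ∈ F', 2 * ((2 * d - 1) * ((e ∩ W).card - 2) + 3 : ℤ) := by
    refine sum_le_sum fun e he => ?_
    rw [hF', mem_filter] at he
    have h1 : (e ∩ W).card < d := by
      rw [← h.uniform e he.1]
      exact card_lt_card (inter_subset_left.ssubset_of_ne fun h => he.2.1 (inter_eq_left.1 h))
    have h2 : (2 : ℤ) ≤ (e ∩ W).card := by exact_mod_cast he.2.2
    have h3 : ((e ∩ W).card : ℤ) + 1 ≤ d := by exact_mod_cast h1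
    have h4 : (3 : ℤ) ≤ d := by exact_mod_cast hd
    -- With `k = |e ∩ W|`, the two sides differ by `(k-2)(4d-5-3k)`, and `2 ≤ k ≤ d - 1` because `e`
    -- leaves `W`.
    nlinarith [mul_nonneg (sub_nonneg.2 h2)
      (by linarith : (0 : ℤ) ≤ 4 * d - 5 - 3 * (e ∩ W).card)]
  have hU : ∑ e ∈ h.edges.filter (· ⊆ W), ((2 * d - 1) * ((e ∩ W).card - 2) + 3 : ℤ) =
      (h.edges.filter (· ⊆ W)).card * (2 * d ^ 2 - 5 * d + 5) := by
    rw [← nsmul_eq_mul, ← sum_const]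
    refine sum_congr rfl fun e he => ?_
    rw [mem_filter] at he
    rw [inter_eq_left.2 he.2, h.uniform e he.1]
    ring
  rw [hsplit, sum_union hdisj, hU]
  rw [← mul_sum, ← mul_sum] at hF
  linarith

/-- An edge of `h` all of whose pairs are covered by other edges of `h` yields a dense
subhypergraph. -/
theorem exists_sub_of_redundant (h : UniformHypergraph d V) (hd : 3 ≤ d) {B : Finset V}
    (hB : B ∈ h.edges)
    (hred : ∀ x ∈ B, ∀ y ∈ B, x ≠ y → ∃ e ∈ h.edges, e ≠ B ∧ x ∈ e ∧ y ∈ e) :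
    ∃ K : h.Sub, (2 * d - 1 : ℤ) * K.verts.card ≤ (2 * d ^ 2 - 5 * d + 5) * K.edges.card := by
  have hBd := h.uniform B hB
  refine h.exists_sub_of_pairs (W := B) (card_pos.1 (by omega)) hd (fun x => B.erase x) ?_ ?_
  · intro x hx y hy
    rw [mem_erase] at hy
    obtain ⟨e, he, hne, hxe, hye⟩ := hred x hx y hy.2 hy.1.symm
    refine ⟨hy.2, hy.1, e, he, fun hsub => hne ?_, hxe, hye⟩
    exact eq_of_subset_of_card_le hsub (by rw [hBd, h.uniform e he])
  · have h1 : (1 : ℤ) ≤ (h.edges.filter (· ⊆ B)).card := by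
      have : 0 < (h.edges.filter (· ⊆ B)).card :=
        card_pos.2 ⟨B, mem_filter.2 ⟨hB, Subset.refl B⟩⟩
      omega
    have h2 : ∑ x ∈ B, ((B.erase x).card : ℤ) = d * (d - 1) := by
      rw [sum_congr rfl fun x hx => by rw [card_erase_of_mem hx, hBd]]
      rw [sum_const, hBd, nsmul_eq_mul, Nat.cast_sub (by omega)]
      simp
    rw [h2, hBd]
    have h3 : (3 : ℤ) ≤ d := by exact_mod_cast hd
    have h4 : (0 : ℤ) ≤ 4 * d ^ 2 - 10 * d + 10 := by nlinarith
    -- With `B` as the only inner edge the slack is `(3d-5)(d-2)`.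
    nlinarith [mul_le_mul_of_nonneg_right h1 h4]

theorem exists_sub_of_proj_eq {h H : UniformHypergraph d V} (hd : 3 ≤ d) (hne : H ≠ h)
    (hproj : H.proj = h.proj) (hcard : H.edges.card ≤ h.edges.card) :
    ∃ K : h.Sub, (2 * d - 1 : ℤ) * K.verts.card ≤ (2 * d ^ 2 - 5 * d + 5) * K.edges.card := by
  set U₀ := h.edges \ H.edges with hU₀
  by_cases hred : ∃ B ∈ U₀, ∀ A ∈ H.edges \ h.edges, (B ∩ A).card < 2
  · obtain ⟨B, hB, hBA⟩ := hred
    rw [hU₀, mem_sdiff] at hB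
    refine h.exists_sub_of_redundant hd hB.1 fun x hx y hy hxy => ?_
    obtain ⟨e, he, hxe, hye⟩ := exists_mem_of_proj_eq hproj.symm hxy hB.1 hx hy
    refine ⟨e, ?_, fun h => hB.2 (h ▸ he), hxe, hye⟩
    by_contra heh
    exact absurd (hBA e (mem_sdiff.2 ⟨he, heh⟩)) (not_lt.2 (one_lt_card.2
      ⟨x, mem_inter.2 ⟨hx, hxe⟩, y, mem_inter.2 ⟨hy, hye⟩, hxy⟩))
  push Not at hred
  -- Dropping the edges that share no pair with `U₀` gives `meet_left`, and keeps `|T₀| ≤ |U₀|`.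
  set T₀ := (H.edges \ h.edges).filter (fun A => ∃ B ∈ U₀, 2 ≤ (A ∩ B).card) with hT₀
  set W := blockSupport T₀ U₀ with hW
  -- With `I` in both families, `U₀ ∪ I` is the set of all edges of `h` inside `W`, so an edge of
  -- `h` outside this family has to leave `W`.
  set I := (h.edges ∩ H.edges).filter (· ⊆ W) with hI
  have hT₀' : ∀ {A}, A ∈ T₀ → A ∈ H.edges ∧ A ∉ h.edges := fun hA =>
    mem_sdiff.1 (mem_filter.1 hA).1
  have hU₀' : ∀ {B}, B ∈ U₀ → B ∈ h.edges ∧ B ∉ H.edges := fun hB => mem_sdiff.1 hB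
  have hI' : ∀ {C}, C ∈ I ↔ (C ∈ h.edges ∧ C ∈ H.edges) ∧ C ⊆ W := fun {C} => by
    rw [hI, mem_filter, mem_inter]
  have hUW : ∀ {B}, B ∈ U₀ → B ⊆ W := fun hB x hx => mem_blockSupport.2 ⟨_, Or.inr hB, hx⟩
  have hTW : ∀ {A}, A ∈ T₀ → A ⊆ W := fun hA x hx => mem_blockSupport.2 ⟨_, Or.inl hA, hx⟩
  have hsupp : blockSupport (T₀ ∪ I) (U₀ ∪ I) = W := by
    refine Subset.antisymm (fun x hx => ?_) (fun x hx => ?_)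
    · obtain ⟨C, hC, hxC⟩ := mem_blockSupport.1 hx
      rw [mem_union, mem_union] at hC
      rcases hC with (hC | hC) | (hC | hC)
      · exact hTW hC hxC
      · exact (hI'.1 hC).2 hxC
      · exact hUW hC hxC
      · exact (hI'.1 hC).2 hxC
    · obtain ⟨C, hC, hxC⟩ := mem_blockSupport.1 hx
      exact mem_blockSupport.2 ⟨C, hC.imp (mem_union_left _) (mem_union_left _), hxC⟩
  have hself : ∀ C ∈ I, 2 ≤ (C ∩ C).card := fun C hC => by
    rw [inter_self, h.uniform C (hI'.1 hC).1.1]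
    omega
  have hpair : IsBlockPair d (T₀ ∪ I) (U₀ ∪ I) := by
    refine ⟨fun C hC => ?_, fun C hC => ?_, fun C hC => ?_, fun C hC => ?_, fun x hx => ?_⟩
    · rcases mem_union.1 hC with hC | hC
      · exact H.uniform C (hT₀' hC).1
      · exact h.uniform C (hI'.1 hC).1.1
    · rcases mem_union.1 hC with hC | hC
      · exact h.uniform C (hU₀' hC).1
      · exact h.uniform C (hI'.1 hC).1.1
    · rcases mem_union.1 hC with hC | hC
      · obtain ⟨B, hB, h2⟩ := (mem_filter.1 hC).2
        exact ⟨B, mem_union_left _ hB, h2⟩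
      · exact ⟨C, mem_union_right _ hC, hself C hC⟩
    · rcases mem_union.1 hC with hC | hC
      · obtain ⟨A, hA, h2⟩ := hred C hC
        exact ⟨A, mem_union_left _ (mem_filter.2 ⟨hA, C, hC, by rwa [inter_comm]⟩), h2⟩
      · exact ⟨C, mem_union_right _ hC, hself C hC⟩
    · rw [hsupp] at hx
      obtain ⟨C, hC | hC, hxC⟩ := mem_blockSupport.1 hx
      · refine ⟨C, hxC, Or.inl ⟨mem_union_left _ hC, fun hCU => (hT₀' hC).2 ?_⟩⟩
        exact (mem_union.1 hCU).elim (fun h => (hU₀' h).1) (fun h => (hI'.1 h).1.1)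
      · refine ⟨C, hxC, Or.inr ⟨mem_union_left _ hC, fun hCT => (hU₀' hC).2 ?_⟩⟩
        exact (mem_union.1 hCT).elim (fun h => (hT₀' h).1) (fun h => (hI'.1 h).1.2)
  have hU : h.edges.filter (· ⊆ W) = U₀ ∪ I := by
    ext e
    rw [mem_filter, mem_union, hI', hU₀, mem_sdiff]
    constructor
    · rintro ⟨h1, h2⟩
      by_cases h3 : e ∈ H.edges
      · exact Or.inr ⟨⟨h1, h3⟩, h2⟩
      · exact Or.inl ⟨h1, h3⟩
    · rintro (h1 | h1)
      · exact ⟨h1.1, hUW (mem_sdiff.2 h1)⟩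
      · exact ⟨h1.1.1, h1.2⟩
  have hTU₀ : T₀.card ≤ U₀.card := by
    refine (card_le_card (filter_subset _ _)).trans ?_
    have h1 := card_sdiff_add_card_inter h.edges H.edges
    have h2 := card_sdiff_add_card_inter H.edges h.edges
    rw [inter_comm] at h2
    rw [← hU₀] at h1
    omega
  have hTU : (T₀ ∪ I).card ≤ (U₀ ∪ I).card := by
    refine (card_union_le _ _).trans ?_
    rw [card_union_of_disjoint]
    · omega
    · rw [disjoint_left]
      exact fun C h1 h2 => (hU₀' h1).2 (hI'.1 h2).1.2
  have hUne : U₀.Nonempty := by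
    rw [hU₀, sdiff_nonempty]
    intro hsub
    exact hne (UniformHypergraph.ext (eq_of_subset_of_card_le hsub hcard).symm)
  have hWne : W.Nonempty := by
    obtain ⟨B, hB⟩ := hUne
    have : B.Nonempty := card_pos.1 (by rw [h.uniform B (hU₀' hB).1]; omega)
    exact this.mono (hUW hB)
  refine h.exists_sub_of_pairs hWne hd (symmNbrs (T₀ ∪ I) (U₀ ∪ I)) ?_ ?_
  · intro x hx y hy
    refine ⟨hsupp ▸ symmNbrs_subset_blockSupport hy, ?_⟩
    rw [mem_symmNbrs, mem_blockNbrs, mem_blockNbrs] at hy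
    have notU : ∀ e, e ∈ h.edges → e ∉ U₀ ∪ I → ¬ e ⊆ W := fun e he hn hsub =>
      hn (hU ▸ mem_filter.2 ⟨he, hsub⟩)
    rcases hy with ⟨⟨hyx, C, hC, hxC, hyC⟩, hn⟩ | ⟨⟨hyx, C, hC, hxC, hyC⟩, hn⟩
    · have hCH : C ∈ H.edges :=
        (mem_union.1 hC).elim (fun h => (hT₀' h).1) (fun h => (hI'.1 h).1.2)
      obtain ⟨e, he, hxe, hye⟩ := exists_mem_of_proj_eq hproj hyx.symm hCH hxC hyC
      exact ⟨hyx, e, he, notU e he fun heU => hn ⟨hyx, e, heU, hxe, hye⟩, hxe, hye⟩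
    · have hCU : C ∈ U₀ := (mem_union.1 hC).resolve_right fun hCI =>
        hn ⟨hyx, C, mem_union_right _ hCI, hxC, hyC⟩
      obtain ⟨e, he, hxe, hye⟩ :=
        exists_mem_of_proj_eq hproj.symm hyx.symm (hU₀' hCU).1 hxC hyC
      -- The edge `e` of `H` shares the pair `x, y` with `C ∈ U₀`; were it not in `h`, it would
      -- belong to `T₀`.
      have heT : e ∉ T₀ ∪ I := fun heT => hn ⟨hyx, e, heT, hxe, hye⟩
      rw [mem_union, not_or] at heT
      have heh : e ∈ h.edges := by
        by_contra heh
        exact heT.1 (mem_filter.2 ⟨mem_sdiff.2 ⟨he, heh⟩, C, hCU, one_lt_card.2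
          ⟨x, mem_inter.2 ⟨hxe, hxC⟩, y, mem_inter.2 ⟨hye, hyC⟩, hyx.symm⟩⟩)
      exact ⟨hyx, e, heh, fun hsub => heT.2 (hI'.2 ⟨⟨heh, he⟩, hsub⟩), hxe, hye⟩
  · have key := hpair.card_blockSupport_le hd
    rw [hsupp] at key
    rw [hU]
    have h1 : ((T₀ ∪ I).card : ℤ) ≤ (U₀ ∪ I).card := by exact_mod_cast hTU
    have h3 : (3 : ℤ) ≤ d := by exact_mod_cast hd
    have h4 : (0 : ℤ) ≤ 4 * d ^ 2 - 10 * d + 10 := by nlinarith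
    have h5 := mul_le_mul_of_nonneg_right h1 h4
    linarith

end

theorem le_maxRatio_of_isAmbiguous [Finite V] (hd : 3 ≤ d) {G : SimpleGraph V}
    (hG : IsAmbiguous d G) (h : UniformHypergraph d V) (hh : h.IsPreimage G) :
    (2 * d - 1 : ℝ) / (2 * d ^ 2 - 5 * d + 5) ≤ h.maxRatio := by
  classical
  obtain ⟨H₁, H₂, hne, h₁, h₂⟩ := hG
  refine h.le_maxRatio_of_exists_sub hd ?_
  -- At least one of the two minimal preimages differs from `h`.
  by_cases h1 : H₁ = h
  · exact exists_sub_of_proj_eq hd (fun h2 => hne (h1.trans h2.symm)) (h₂.1.trans hh.symm)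
      (h₂.2 h hh)
  · exact exists_sub_of_proj_eq hd h1 (h₁.1.trans hh.symm) (h₁.2 h hh)

end UniformHypergraph

/-! ### The extremal example -/

namespace AmbiguousExample

variable {d : ℕ}

/-- The `k`-th element of the set `S_i^u` (for `true`) or `S_i^w` (for `false`). -/
abbrev leaf (b : Bool) (i : Fin (d - 1)) (k : Fin (d - 2)) : Vertex d := Sum.inr (Sum.inr (b, i, k))

theorem leaf_mem_petal {b b' : Bool} {i i' : Fin (d - 1)} {k : Fin (d - 2)} :
    leaf b i k ∈ petal b' i' ↔ b' = b ∧ i' = i := by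
  simp [petal, leaves]

theorem mid_mem_petal {b : Bool} {i j : Fin (d - 1)} : mid i ∈ petal b j ↔ i = j := by
  simp [petal, leaves]

theorem apex_mem_petal {b b' : Bool} {i : Fin (d - 1)} : apex d b' ∈ petal b i ↔ b' = b := by
  simp [petal, leaves]

theorem mem_center {b : Bool} {x : Vertex d} : x ∈ center d b ↔ x = apex d b ∨ ∃ i, mid i = x := by
  simp [center]

theorem mem_hypergraph {hd : 2 ≤ d} {c : Bool} {e : Finset (Vertex d)} :
    e ∈ (hypergraph d hd c).edges ↔ e = center d c ∨ ∃ b i, petal b i = e := by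
  simp [hypergraph]

theorem eq_petal_of_leaf_mem {hd : 2 ≤ d} {c b : Bool} {i : Fin (d - 1)} {k : Fin (d - 2)}
    {e : Finset (Vertex d)} (he : e ∈ (hypergraph d hd c).edges) (hl : leaf b i k ∈ e) :
    e = petal b i := by
  rcases mem_hypergraph.1 he with rfl | ⟨b', i', rfl⟩
  · simp [center] at hl
  · obtain ⟨rfl, rfl⟩ := leaf_mem_petal.1 hl
    rfl

/-- Exchanging the centers loses nothing: the pairs of an apex with the `v_i` are already in petals,
and either center covers the pairs among the `v_i`. -/
theorem proj_le (hd : 2 ≤ d) (c c' : Bool) :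
    (hypergraph d hd c).proj ≤ (hypergraph d hd c').proj := by
  rintro x y ⟨hxy, e, he, hx, hy⟩
  refine ⟨hxy, ?_⟩
  rcases mem_hypergraph.1 he with rfl | ⟨b, i, rfl⟩
  · rcases mem_center.1 hx with rfl | ⟨i, rfl⟩ <;> rcases mem_center.1 hy with rfl | ⟨j, rfl⟩
    · exact absurd rfl hxy
    · exact ⟨petal c j, mem_hypergraph.2 (Or.inr ⟨c, j, rfl⟩), apex_mem_petal.2 rfl,
        mid_mem_petal.2 rfl⟩
    · exact ⟨petal c i, mem_hypergraph.2 (Or.inr ⟨c, i, rfl⟩), mid_mem_petal.2 rfl,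
        apex_mem_petal.2 rfl⟩
    · exact ⟨center d c', mem_hypergraph.2 (Or.inl rfl), mem_center.2 (Or.inr ⟨i, rfl⟩),
        mem_center.2 (Or.inr ⟨j, rfl⟩)⟩
  · exact ⟨petal b i, mem_hypergraph.2 (Or.inr ⟨b, i, rfl⟩), hx, hy⟩

theorem isPreimage (hd : 2 ≤ d) (c : Bool) : (hypergraph d hd c).IsPreimage (graph d hd) :=
  le_antisymm (proj_le hd c true) (proj_le hd true c)

/-- All neighbours of a leaf lie in its petal, so any edge through the leaf is that petal. A leaf
exists because `d ≥ 3`. -/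
theorem petal_mem_of_isPreimage (hd : 3 ≤ d) {H : UniformHypergraph d (Vertex d)}
    (hH : H.IsPreimage (graph d (le_of_lt hd))) (b : Bool) (i : Fin (d - 1)) :
    petal b i ∈ H.edges := by
  let k : Fin (d - 2) := ⟨0, by omega⟩
  have hadj : (graph d (le_of_lt hd)).Adj (leaf b i k) (apex d b) :=
    ⟨by simp, petal b i, mem_hypergraph.2 (Or.inr ⟨b, i, rfl⟩), leaf_mem_petal.2 ⟨rfl, rfl⟩,
      apex_mem_petal.2 rfl⟩
  rw [← hH] at hadj
  obtain ⟨-, e, he, hl, -⟩ := hadj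
  have hsub : e ⊆ petal b i := by
    intro y hy
    by_cases hly : leaf b i k = y
    · exact hly ▸ leaf_mem_petal.2 ⟨rfl, rfl⟩
    · have hadj : H.proj.Adj (leaf b i k) y := ⟨hly, e, he, hl, hy⟩
      rw [hH] at hadj
      obtain ⟨-, e', he', hl', hy'⟩ := hadj
      rwa [eq_petal_of_leaf_mem he' hl'] at hy'
  rwa [← eq_of_subset_of_card_le hsub (by rw [card_petal (le_of_lt hd), H.uniform e he])]

theorem ne_petal_of_mem {e : Finset (Vertex d)} {i j : Fin (d - 1)} (hij : i ≠ j)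
    (hi : mid i ∈ e) (hj : mid j ∈ e) (b : Bool) (l : Fin (d - 1)) : petal b l ≠ e := by
  rintro rfl
  exact hij ((mid_mem_petal.1 hi).trans (mid_mem_petal.1 hj).symm)

/-- Beyond the forced petals, a preimage needs an edge through two of the `v_i`, which no petal
contains. -/
theorem isMinimalPreimage (hd : 3 ≤ d) (c : Bool) :
    (hypergraph d (le_of_lt hd) c).IsMinimalPreimage (graph d (le_of_lt hd)) := by
  refine ⟨isPreimage _ c, fun H hH => ?_⟩
  let i : Fin (d - 1) := ⟨0, by omega⟩
  let j : Fin (d - 1) := ⟨1, by omega⟩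
  have hij : i ≠ j := by simp [i, j]
  have hadj : (graph d (le_of_lt hd)).Adj (mid i) (mid j) :=
    ⟨by simp [hij], center d true, mem_hypergraph.2 (Or.inl rfl), mem_center.2 (Or.inr ⟨i, rfl⟩),
      mem_center.2 (Or.inr ⟨j, rfl⟩)⟩
  rw [← hH] at hadj
  obtain ⟨-, e, he, hi, hj⟩ := hadj
  have hnot : e ∉ Finset.univ.image fun x : Bool × Fin (d - 1) => petal x.1 x.2 := by
    rw [mem_image]
    rintro ⟨x, -, hx⟩
    exact ne_petal_of_mem hij hi hj x.1 x.2 hx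
  refine (card_insert_le _ _).trans ?_
  rw [← card_insert_of_notMem hnot]
  refine card_le_card (insert_subset he fun f hf => ?_)
  obtain ⟨x, -, rfl⟩ := mem_image.1 hf
  exact petal_mem_of_isPreimage hd hH x.1 x.2

theorem isAmbiguous (hd : 3 ≤ d) : IsAmbiguous d (graph d (le_of_lt hd)) := by
  refine ⟨hypergraph d (le_of_lt hd) true, hypergraph d (le_of_lt hd) false, fun h => ?_,
    isMinimalPreimage hd true, isMinimalPreimage hd false⟩
  have hmem : center d true ∈ (hypergraph d (le_of_lt hd) true).edges :=
    mem_hypergraph.2 (Or.inl rfl)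
  rw [h] at hmem
  rcases mem_hypergraph.1 hmem with h1 | ⟨b, i, h1⟩
  · have : apex d true ∈ center d false := h1 ▸ mem_center.2 (Or.inl rfl)
    simp [center] at this
  · refine ne_petal_of_mem (i := ⟨0, by omega⟩) (j := ⟨1, by omega⟩) (by simp)
      (mem_center.2 (Or.inr ⟨_, rfl⟩)) (mem_center.2 (Or.inr ⟨_, rfl⟩)) b i h1

/-- Here `p` and `q` count the petals at the two apexes, `l` the apexes, `m` the `v_i` and `e` the
edges; the second alternative of `he` allows for the center. As `2d²-5d+5 = (2d-1)(d-2) + 3`, the `d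
- 2` leaves of a petal pay for all but 3 of its cost, and the apexes and the `v_i` pay the rest.
Equality holds for the whole hypergraph, where `p = q = m = d - 1`, `l = 2` and `e = 2d - 1`. -/
theorem density_le {d p q m l e : ℤ} (hd : 3 ≤ d) (hp : 0 ≤ p) (hq : 0 ≤ q) (hpm : p ≤ m)
    (hqm : q ≤ m) (hm : m ≤ d - 1) (hl0 : 0 ≤ l) (hl1 : 0 < p ∨ 0 < q → 1 ≤ l)
    (he : e ≤ p + q ∨ e ≤ p + q + 1 ∧ m = d - 1 ∧ (2 ≤ l ∨ 1 ≤ l ∧ (p = 0 ∨ q = 0))) :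
    (2 * d ^ 2 - 5 * d + 5) * e ≤ (2 * d - 1) * (l + m + (p + q) * (d - 2)) := by
  have hc : 0 ≤ 2 * d ^ 2 - 5 * d + 5 := by nlinarith
  rcases he with he | ⟨he, rfl, hl⟩
  · have h1 := mul_le_mul_of_nonneg_left he hc
    have h2 : 3 * (p + q) ≤ (2 * d - 1) * (l + m) := by
      by_cases hpq : 0 < p ∨ 0 < q
      · nlinarith [hl1 hpq, mul_nonneg (sub_nonneg.2 hd) (hp.trans hpm)]
      · have hp0 : p = 0 := by omega
        have hq0 : q = 0 := by omega
        subst hp0 hq0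
        have := mul_nonneg (by linarith : (0 : ℤ) ≤ 2 * d - 1) (add_nonneg hl0 hpm)
        linarith
    nlinarith
  · have h1 := mul_le_mul_of_nonneg_left he hc
    have h2 : 3 * (p + q + 1) ≤ (2 * d - 1) * (l + 1) := by
      rcases hl with hl | ⟨hl, rfl | rfl⟩ <;> nlinarith
    nlinarith

theorem sub_density_le (hd : 3 ≤ d) (c : Bool) (K : (hypergraph d (le_of_lt hd) c).Sub) :
    (2 * d ^ 2 - 5 * d + 5 : ℤ) * K.edges.card ≤ (2 * d - 1) * K.verts.card := by
  classical
  let P : Bool → Finset (Fin (d - 1)) := fun b => univ.filter fun i => petal b i ∈ K.edges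
  have hP : ∀ {b i}, i ∈ P b ↔ petal b i ∈ K.edges := fun {b i} => by
    simp only [P, mem_filter, mem_univ, true_and]
  have hsub : ∀ {b i x}, i ∈ P b → x ∈ petal b i → x ∈ K.verts := fun hi hx =>
    K.edge_subset_verts _ (hP.1 hi) hx
  let L : Finset Bool := K.verts.toLeft
  let M : Finset (Fin (d - 1)) := K.verts.toRight.toLeft
  let N : Finset (Bool × Fin (d - 1) × Fin (d - 2)) := K.verts.toRight.toRight
  have hcard : L.card + (M.card + N.card) = K.verts.card := by
    rw [card_toLeft_add_card_toRight, card_toLeft_add_card_toRight]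
  have hL : ∀ {b}, (P b).Nonempty → b ∈ L := fun ⟨i, hi⟩ =>
    mem_toLeft.2 (hsub hi (apex_mem_petal.2 rfl))
  have hM : ∀ b, P b ⊆ M := fun b i hi =>
    mem_toLeft.2 (mem_toRight.2 (hsub hi (mid_mem_petal.2 rfl)))
  have hN : ((P true).card + (P false).card) * (d - 2) ≤ N.card := by
    have h1 : ({true} : Finset Bool) ×ˢ P true ×ˢ (univ : Finset (Fin (d - 2))) ∪
        ({false} : Finset Bool) ×ˢ P false ×ˢ (univ : Finset (Fin (d - 2))) ⊆ N := by
      rintro ⟨b, i, k⟩ hx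
      simp only [mem_union, mem_product, mem_singleton, mem_univ, and_true] at hx
      refine mem_toRight.2 (mem_toRight.2 ?_)
      rcases hx with ⟨rfl, hi⟩ | ⟨rfl, hi⟩ <;> exact hsub hi (leaf_mem_petal.2 ⟨rfl, rfl⟩)
    have h2 := card_le_card h1
    rw [card_union_of_disjoint] at h2
    · simpa [card_product, add_mul] using h2
    · rw [disjoint_left]
      rintro ⟨b, i, k⟩ h1 h2
      simp only [mem_product, mem_singleton] at h1 h2
      exact absurd (h1.1.symm.trans h2.1) (by simp)
  have hpet : ∀ e ∈ K.edges, e ≠ center d c →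
      e ∈ (P true).image (petal true) ∪ (P false).image (petal false) := by
    intro e he hne
    obtain ⟨b, i, rfl⟩ := (mem_hypergraph.1 (K.edges_subset he)).resolve_left hne
    rw [mem_union, mem_image, mem_image]
    cases b
    · exact Or.inr ⟨i, hP.2 he, rfl⟩
    · exact Or.inl ⟨i, hP.2 he, rfl⟩
  have hpetcard : ((P true).image (petal true) ∪ (P false).image (petal false)).card ≤
      (P true).card + (P false).card :=
    (card_union_le _ _).trans (add_le_add card_image_le card_image_le)
  have hMd : M.card ≤ d - 1 := by simpa using card_le_univ M
  have hpm := card_le_card (hM true)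
  have hqm := card_le_card (hM false)
  have hposL : ∀ {b}, 0 < (P b).card → b ∈ L := fun h => hL (card_pos.1 h)
  have hmain : (2 * d ^ 2 - 5 * d + 5 : ℤ) * K.edges.card ≤ (2 * d - 1) *
      (L.card + M.card + ((P true).card + (P false).card) * (d - 2)) := by
    refine density_le (by exact_mod_cast hd) (by positivity) (by positivity)
      (by exact_mod_cast hpm) (by exact_mod_cast hqm) (by omega) (by positivity) ?_ ?_
    · intro h
      have : 0 < L.card := by
        rcases h with h | h
        · exact card_pos.2 ⟨_, hposL (by exact_mod_cast h)⟩
        · exact card_pos.2 ⟨_, hposL (by exact_mod_cast h)⟩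
      omega
    · by_cases hcen : center d c ∈ K.edges
      · have hcL : c ∈ L := mem_toLeft.2 (K.edge_subset_verts _ hcen (mem_center.2 (Or.inl rfl)))
        have hMu : M = univ := eq_univ_of_forall fun i => mem_toLeft.2 (mem_toRight.2
          (K.edge_subset_verts _ hcen (mem_center.2 (Or.inr ⟨i, rfl⟩))))
        have hMc : M.card = d - 1 := by rw [hMu]; simp
        have h1 : K.edges.card ≤ (P true).card + (P false).card + 1 := by
          have h2 : K.edges ⊆ insert (center d c)
              ((P true).image (petal true) ∪ (P false).image (petal false)) := fun e he =>
            mem_insert.2 (or_iff_not_imp_left.2 (hpet e he))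
          have := (card_le_card h2).trans (card_insert_le _ _)
          omega
        have h3 : 1 ≤ L.card := card_pos.2 ⟨c, hcL⟩
        -- The center brings in only its own apex; the other one is present as soon as a petal uses
        -- it.
        have h4 : (P (!c)).card = 0 ∨ 2 ≤ L.card := by
          rw [or_iff_not_imp_left]
          intro h
          exact one_lt_card.2 ⟨c, hcL, !c, hposL (Nat.pos_of_ne_zero h), by cases c <;> simp⟩
        refine Or.inr ⟨by omega, by omega, ?_⟩
        cases c
        · simp only [Bool.not_false] at h4
          omega
        · simp only [Bool.not_true] at h4
          omega
      · refine Or.inl ?_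
        have h2 := card_le_card fun e he => hpet e he fun h => hcen (h ▸ he)
        omega
  refine hmain.trans (mul_le_mul_of_nonneg_left ?_ (by omega))
  have hN' : (((P true).card + (P false).card) * (d - 2) : ℤ) ≤ N.card := by
    have : ((d - 2 : ℕ) : ℤ) = d - 2 := by omega
    rw [← this]
    exact_mod_cast hN
  have : (L.card + (M.card + N.card) : ℤ) = K.verts.card := by exact_mod_cast hcard
  linarith

/-- The lower bound is the general inequality applied to this ambiguous graph; only the upper bound
uses the structure of the example. -/
theorem maxRatio_eq (hd : 3 ≤ d) (c : Bool) :
    (hypergraph d (le_of_lt hd) c).maxRatio = (2 * d - 1 : ℝ) / (2 * d ^ 2 - 5 * d + 5) := by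
  refine le_antisymm ?_ (UniformHypergraph.le_maxRatio_of_isAmbiguous hd (isAmbiguous hd) _
    (isPreimage _ c))
  have : Nonempty (Vertex d) := ⟨apex d true⟩
  obtain ⟨⟨K, hK⟩, -⟩ := (hypergraph d (le_of_lt hd) c).isGreatest_maxRatio
  rw [← hK]
  have hd' : (3 : ℝ) ≤ d := by exact_mod_cast hd
  have hv : (0 : ℝ) < K.verts.card := by exact_mod_cast K.nonempty.card_pos
  have hq : (0 : ℝ) < 2 * d ^ 2 - 5 * d + 5 := by nlinarith
  have h : (2 * d ^ 2 - 5 * d + 5 : ℝ) * K.edges.card ≤ (2 * d - 1) * K.verts.card := by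
    exact_mod_cast sub_density_le hd c K
  change K.ratio ≤ _
  rw [UniformHypergraph.Sub.ratio, div_le_div_iff₀ hv hq]
  linarith

end AmbiguousExample

theorem mainTheorem6 (d : ℕ) (hd : 3 ≤ d) :
    (∀ {V : Type*} [Finite V] (G : SimpleGraph V), IsAmbiguous d G →
      ∀ h : UniformHypergraph d V, h.IsPreimage G →
        (2 * (d : ℝ) - 4) / (2 * (d : ℝ) - 1) ≤ (d : ℝ) - 1 - 1 / h.maxRatio) ∧
    IsAmbiguous d (AmbiguousExample.graph d (le_of_lt hd)) ∧
    ∀ c : Bool,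
      (AmbiguousExample.hypergraph d (le_of_lt hd) c).IsMinimalPreimage
        (AmbiguousExample.graph d (le_of_lt hd)) ∧
      (d : ℝ) - 1 - 1 / (AmbiguousExample.hypergraph d (le_of_lt hd) c).maxRatio =
        (2 * (d : ℝ) - 4) / (2 * (d : ℝ) - 1) := by
  refine ⟨fun G hG h hh => ?_, AmbiguousExample.isAmbiguous hd, fun c =>
    ⟨AmbiguousExample.isMinimalPreimage hd c, ?_⟩⟩
  · have hm := UniformHypergraph.le_maxRatio_of_isAmbiguous hd hG h hh
    have hd' : (3 : ℝ) ≤ d := by exact_mod_cast hd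
    have hα : (0 : ℝ) < (2 * d - 1) / (2 * d ^ 2 - 5 * d + 5) :=
      div_pos (by linarith) (by nlinarith)
    rw [UniformHypergraph.threshold_eq hd]
    exact sub_le_sub_left (one_div_le_one_div_of_le hα hm) _
  · rw [AmbiguousExample.maxRatio_eq hd c, UniformHypergraph.threshold_eq hd]
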